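/- Let $X$ and $Y$ be real Banach spaces and let $A\subset X$, $B\subset Y$ be arbitrary subsets. Write $\mathrm{co}$ and $\mathrm{aff}$ for convex and affine hull. A convex polyhedron is the convex hull $H$ of a nonempty finite set of points; its vertex set $\mathrm{vert}(H)$ is the set of its extreme points. For integers $n,m\ge 0$, an $(n,m)$-polyhedron is a convex polyhedron $H$ such that $\dim \mathrm{aff}(H)=n$ and $\mathrm{vert}(H)$ has exactly $n+m+1$ elements. We say that $A$ is finitely representable in $B$ if for every $\varepsilon>0$, every integer $n\ge 0$ and all affinely independent $x_0,\dots,x_n\in A$ there are affinely independent $y_0,\dots,y_n\in B$ and an affine isomorphism $T:\mathrm{aff}(S)\to\mathrm{aff}(S')$, where $S=\mathrm{co}(x_0,\dots,x_n)$ and $S'=\mathrm{co}(y_0,\dots,y_n)$, such that $Tx_j=y_j$ for $j=0,\dots,n$ and $$(1-\varepsilon)\|x-y\|\le\|Tx-Ty\|\le(1+\varepsilon)\|x-y\|\qquad\text{for all }x,y\in\mathrm{aff}(S).$$ We say that $A$ is strongly finitely representable in $B$ if for every $\varepsilon>0$, all integers $n,m\ge0$ and every $(n,m)$-polyhedron $H\subset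 X$ with $\mathrm{vert}(H)\subset A$ there are an $(n,m)$-polyhedron $H'\subset Y$ with $\mathrm{vert}(H')\subset B$ and an affine isomorphism $T:\mathrm{aff}(H)\to\mathrm{aff}(H')$ such that $$(1-\varepsilon)\|x-y\|\le\|Tx-Ty\|\le(1+\varepsilon)\|x-y\|\qquad\text{for all }x,y\in\mathrm{aff}(H)$$ and $d_{\mathfrak H}\big(\mathrm{vert}(T(H)),\mathrm{vert}(H')\big)<\varepsilon$, where $d_{\mathfrak H}$ is the Hausdorff distance in $Y$. **Corollary 4.10.** i) If $A$ is finitely representable in $B$, then there is a countable subset $B_0$ of $B$ such that $A$ is finitely representable in $B_0$. ii) If $A$ is strongly finitely representable in $B$, then there is a countable subset $B_0$ of $B$ such that $A$ is strongly finitely representable in $B_0$. -/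

import Mathlib

/-- The vertex set of `H`: the set of its extreme points. -/
def vert {X : Type*} [NormedAddCommGroup X] [NormedSpace ℝ X] (H : Set X) : Set X :=
  Set.extremePoints ℝ H

/-- A convex polyhedron: the convex hull of a nonempty finite family of points. -/
def IsConvexPolyhedron {X : Type*} [NormedAddCommGroup X] [NormedSpace ℝ X] (H : Set X) : Prop :=
  ∃ (k : ℕ) (z : Fin (k + 1) → X), H = convexHull ℝ (Set.range z)

/-- An `(n, m)`-polyhedron: a convex polyhedron with `n`-dimensional affine hull and exactly
`n + m + 1` vertices. -/
structure IsNMPolyhedron {X : Type*} [NormedAddCommGroup X] [NormedSpace ℝ X]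
    (n m : ℕ) (H : Set X) : Prop where
  isConvexPolyhedron : IsConvexPolyhedron H
  dim_eq : Module.finrank ℝ (affineSpan ℝ H).direction = n
  card_vert : (vert H).ncard = n + m + 1

/-- The convex hull of a nonempty set is nonempty; this makes `affineSpan ℝ (convexHull ℝ s)`
an affine space, so that affine isomorphisms from and onto it make sense. -/
instance instNonemptyConvexHull {X : Type*} [NormedAddCommGroup X] [NormedSpace ℝ X]
    (s : Set X) [Nonempty s] : Nonempty (convexHull ℝ s) :=
  (convexHull_nonempty_iff.mpr (Set.nonempty_coe_sort.mp inferInstance)).to_subtype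

/-- The two-sided estimate `(1 - ε)‖x - y‖ ≤ ‖T x - T y‖ ≤ (1 + ε)‖x - y‖` for an affine
isomorphism `T` between the affine hulls of `H` and `H'`. -/
def IsAlmostIsometry {X Y : Type*} [NormedAddCommGroup X] [NormedSpace ℝ X]
    [NormedAddCommGroup Y] [NormedSpace ℝ Y] {H : Set X} {H' : Set Y} [Nonempty H] [Nonempty H']
    (ε : ℝ) (T : affineSpan ℝ H ≃ᵃ[ℝ] affineSpan ℝ H') : Prop :=
  ∀ x y : affineSpan ℝ H,
    (1 - ε) * ‖(x : X) - (y : X)‖ ≤ ‖(T x : Y) - (T y : Y)‖ ∧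
      ‖(T x : Y) - (T y : Y)‖ ≤ (1 + ε) * ‖(x : X) - (y : X)‖

/-- `A` is `ε`-finitely representable in `B`. An `n`-simplex is given by its `n + 1` affinely
independent vertices. -/
def IsEpsFinitelyRepresentable {X Y : Type*} [NormedAddCommGroup X] [NormedSpace ℝ X]
    [NormedAddCommGroup Y] [NormedSpace ℝ Y] (ε : ℝ) (A : Set X) (B : Set Y) : Prop :=
  ∀ (n : ℕ) (x : Fin (n + 1) → X), AffineIndependent ℝ x → (∀ j, x j ∈ A) →
    ∃ y : Fin (n + 1) → Y, AffineIndependent ℝ y ∧ (∀ j, y j ∈ B) ∧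
      ∃ T : affineSpan ℝ (convexHull ℝ (Set.range x)) ≃ᵃ[ℝ]
          affineSpan ℝ (convexHull ℝ (Set.range y)),
        (∀ (p : affineSpan ℝ (convexHull ℝ (Set.range x))) (j : Fin (n + 1)),
          (p : X) = x j → (T p : Y) = y j) ∧
        IsAlmostIsometry ε T

/-- `A` is finitely representable in `B`. -/
def IsFinitelyRepresentable {X Y : Type*} [NormedAddCommGroup X] [NormedSpace ℝ X]
    [NormedAddCommGroup Y] [NormedSpace ℝ Y] (A : Set X) (B : Set Y) : Prop :=
  ∀ ε : ℝ, 0 < ε → IsEpsFinitelyRepresentable ε A B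

/-- `A` is `ε`-strongly finitely representable in `B`. The polyhedra `H` and `H'` are automatically
nonempty; `[Nonempty H]` is there only to let the affine hulls be affine spaces. The set
`T(H)` is taken as a subset of `Y`. -/
def IsEpsStronglyFinitelyRepresentable {X Y : Type*} [NormedAddCommGroup X] [NormedSpace ℝ X]
    [NormedAddCommGroup Y] [NormedSpace ℝ Y] (ε : ℝ) (A : Set X) (B : Set Y) : Prop :=
  ∀ (n m : ℕ) (H : Set X) [Nonempty H], IsNMPolyhedron n m H → vert H ⊆ A →
    ∃ (H' : Set Y) (_ : Nonempty H'), IsNMPolyhedron n m H' ∧ vert H' ⊆ B ∧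
      ∃ T : affineSpan ℝ H ≃ᵃ[ℝ] affineSpan ℝ H',
        IsAlmostIsometry ε T ∧
        Metric.hausdorffDist
          (vert ((fun p : affineSpan ℝ H => (T p : Y)) '' {p | (p : X) ∈ H})) (vert H') < ε

/-- `A` is strongly finitely representable in `B`. -/
def IsStronglyFinitelyRepresentable {X Y : Type*} [NormedAddCommGroup X] [NormedSpace ℝ X]
    [NormedAddCommGroup Y] [NormedSpace ℝ Y] (A : Set X) (B : Set Y) : Prop :=
  ∀ ε : ℝ, 0 < ε → IsEpsStronglyFinitelyRepresentable ε A B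

/-! Both notions are transitive, so it suffices to represent `B` itself in a countable subset of
`B`. Encode a tuple `y` from `B` by the function `c ↦ ‖∑ cᵢ (yᵢ - y₀)‖` on the unit ball of
coefficients. These functions lie in a separable space, so countably many admissible tuples
approximate all the others (`exists_countable_normClose`); collect their entries over all `n` (and
`m`).

Tuples with close functions and affine hulls of equal dimension are related by an affine almost
isometry that nearly matches their points, and matches them exactly when the first tuple is affinely
independent (`exists_affineEquiv_of_normClose`). -/

/-- Two finite families of vectors are `δ`-close in norm if the norms of their linear combinations
with coefficients `c` differ by at most `δ * ‖c‖`. -/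
def NormClose {ι E F : Type*} [Fintype ι] [NormedAddCommGroup E] [NormedSpace ℝ E]
    [NormedAddCommGroup F] [NormedSpace ℝ F] (δ : ℝ) (v : ι → E) (w : ι → F) : Prop :=
  ∀ c : ι → ℝ, |‖Fintype.linearCombination ℝ w c‖ - ‖Fintype.linearCombination ℝ v c‖| ≤ δ * ‖c‖

/-! ### Separability of the space of norm functions -/

section Selection

variable {ι E : Type*} [Fintype ι] [NormedAddCommGroup E] [NormedSpace ℝ E]

/-- The norm of linear combinations of `v`, as a continuous function on the unit ball. -/
def combinationNorm (v : ι → E) : C(Metric.closedBall (0 : ι → ℝ) 1, ℝ) where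
  toFun c := ‖Fintype.linearCombination ℝ v c‖
  continuous_toFun := by
    simp only [Fintype.linearCombination_apply]
    exact (continuous_finsetSum _ fun i _ =>
      ((continuous_apply i).comp continuous_subtype_val).smul continuous_const).norm

theorem normClose_of_dist_combinationNorm_le {δ : ℝ} {v w : ι → E}
    (h : dist (combinationNorm w) (combinationNorm v) ≤ δ) : NormClose δ v w := by
  intro c
  rcases eq_or_ne c 0 with rfl | hc
  · simp
  have hc' : 0 < ‖c‖ := norm_pos_iff.mpr hc
  have hmem : ‖c‖⁻¹ • c ∈ Metric.closedBall (0 : ι → ℝ) 1 := by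
    simp [norm_smul, hc'.ne']
  have h1 := (ContinuousMap.dist_apply_le_dist ⟨_, hmem⟩).trans h
  rw [Real.dist_eq] at h1
  simp only [combinationNorm, ContinuousMap.coe_mk, map_smul, norm_smul, norm_inv, norm_norm,
    ← mul_sub, abs_mul, abs_inv, abs_norm] at h1
  rwa [inv_mul_le_iff₀ hc', mul_comm] at h1

/-- Every set of finite families of vectors has a countable subset that is dense with respect to
norm closeness. -/
theorem exists_countable_normClose {α : Type*} (S : Set α) (f : α → ι → E) :
    ∃ D ⊆ S, D.Countable ∧ ∀ a ∈ S, ∀ δ > 0, ∃ b ∈ D, NormClose δ (f a) (f b) := by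
  -- The ball is compact, so the space of continuous functions on it is separable. The dense set is
  -- taken inside the image of `S`, hence its points come from members of `S`.
  obtain ⟨t, hts, htc, hst⟩ := (TopologicalSpace.IsSeparable.of_separableSpace
    ((fun a => combinationNorm (f a)) '' S)).exists_countable_dense_subset
  choose p hpS hp using hts
  have := htc.to_subtype
  refine ⟨Set.range fun g : t => p g.2, Set.range_subset_iff.mpr fun g => hpS g.2,
    Set.countable_range _, fun a ha δ hδ => ?_⟩
  obtain ⟨g, hg, hag⟩ := Metric.mem_closure_iff.mp (hst ⟨a, ha, rfl⟩) δ hδ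
  refine ⟨p hg, ⟨⟨g, hg⟩, rfl⟩, normClose_of_dist_combinationNorm_le ?_⟩
  rw [dist_comm]
  exact (congrArg (dist _) (hp hg)).trans_le hag.le

end Selection

/-! ### Almost isometries from close norms -/

/-- If `w` is sufficiently close in norm to `v`, and both span spaces of the same dimension, there
is an almost isometry between the spans that almost maps `v` to `w`. -/
theorem exists_linearEquiv_of_normClose {ι E : Type*} [Fintype ι] [NormedAddCommGroup E]
    [NormedSpace ℝ E] (v : ι → E) {ε : ℝ} (hε : 0 < ε) :
    ∃ δ > 0, ∀ (w : ι → E) (V W : Submodule ℝ E), NormClose δ v w →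
      V = Submodule.span ℝ (Set.range v) → W = Submodule.span ℝ (Set.range w) →
      Module.finrank ℝ V = Module.finrank ℝ W →
      ∃ T : V ≃ₗ[ℝ] W,
        (∀ x : V, (1 - ε) * ‖(x : E)‖ ≤ ‖(T x : E)‖ ∧ ‖(T x : E)‖ ≤ (1 + ε) * ‖(x : E)‖) ∧
        (∀ (x : V) (i : ι), (x : E) = v i → ‖(T x : E) - w i‖ < ε) ∧
        (LinearMap.ker (Fintype.linearCombination ℝ v) ≤
            LinearMap.ker (Fintype.linearCombination ℝ w) →
          ∀ (x : V) (i : ι), (x : E) = v i → (T x : E) = w i) := by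
  classical
  set V₀ := Submodule.span ℝ (Set.range v) with hV₀
  have hrange : LinearMap.range (Fintype.linearCombination ℝ v) = V₀ :=
    Fintype.range_linearCombination ℝ v
  let L : (ι → ℝ) →ₗ[ℝ] V₀ := (Fintype.linearCombination ℝ v).codRestrict V₀
    fun c => hrange ▸ LinearMap.mem_range_self _ c
  have hL : LinearMap.range L = ⊤ := by
    rw [LinearMap.range_eq_top]
    rintro ⟨x, hx⟩
    rw [← hrange] at hx
    obtain ⟨c, hc⟩ := hx
    exact ⟨c, Subtype.ext hc⟩
  -- Since `v` may be linearly dependent, `vᵢ ↦ wᵢ` need not extend linearly. A linear choice `s` of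
  -- coefficients is fixed, and the map will be `x ↦ ∑ (s x)ᵢ wᵢ`.
  obtain ⟨s, hs⟩ := L.exists_rightInverse_of_surjective hL
  have hsv : ∀ x : V₀, Fintype.linearCombination ℝ v (s x) = x := fun x =>
    congrArg Subtype.val (LinearMap.congr_fun hs x)
  have : FiniteDimensional ℝ V₀ := FiniteDimensional.span_of_finite ℝ (Set.finite_range v)
  let s' : V₀ →L[ℝ] (ι → ℝ) := LinearMap.toContinuousLinearMap s
  have hs' : ∀ x : V₀, ‖s x‖ ≤ ‖s'‖ * ‖(x : E)‖ := fun x => s'.le_opNorm x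
  let e : ι → V₀ := fun i => ⟨v i, Submodule.subset_span ⟨i, rfl⟩⟩
  have hker : ∀ i, Fintype.linearCombination ℝ v (s (e i) - Pi.single i 1) = 0 := by
    intro i
    rw [map_sub, hsv, Fintype.linearCombination_apply_single]
    simp [e]
  -- `K` bounds both the section and the relations `s (e i) - Pi.single i 1` of `v`; the `1` keeps
  -- it positive.
  set K := ‖s'‖ + ∑ i, ‖s (e i) - Pi.single i 1‖ + 1 with hK
  have hsum : 0 ≤ ∑ i, ‖s (e i) - Pi.single i 1‖ := Finset.sum_nonneg fun _ _ => norm_nonneg _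
  have hKpos : 0 < K := by positivity
  have hK1 : ‖s'‖ ≤ K := by linarith
  have hK2 : ∀ i, ‖s (e i) - Pi.single i 1‖ ≤ K := fun i => by
    have := Finset.single_le_sum (f := fun i => ‖s (e i) - Pi.single i 1‖)
      (fun _ _ => norm_nonneg _) (Finset.mem_univ i)
    have h0 := norm_nonneg s'
    linarith
  set η := min ε 1 / 2 with hη
  have hηpos : 0 < η := by positivity
  have hη1 : η < 1 := by have := min_le_right ε 1; linarith
  have hηε : η < ε := by have := min_le_left ε 1; linarith
  refine ⟨η / K, by positivity, ?_⟩
  rintro w _ W hvw rfl rfl hfin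
  have hrange' : LinearMap.range (Fintype.linearCombination ℝ w) = Submodule.span ℝ (Set.range w) :=
    Fintype.range_linearCombination ℝ w
  let T₀ : V₀ →ₗ[ℝ] Submodule.span ℝ (Set.range w) :=
    ((Fintype.linearCombination ℝ w).comp s).codRestrict _
      fun c => hrange' ▸ LinearMap.mem_range_self _ (s c)
  have hT₀ : ∀ x, (T₀ x : E) = Fintype.linearCombination ℝ w (s x) := fun x => rfl
  have hest : ∀ x : V₀, |‖(T₀ x : E)‖ - ‖(x : E)‖| ≤ η * ‖(x : E)‖ := by
    intro x
    have h1 := hvw (s x)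
    rw [hsv, ← hT₀] at h1
    refine h1.trans ?_
    calc η / K * ‖s x‖ ≤ η / K * (K * ‖(x : E)‖) := by
          gcongr
          exact (hs' x).trans (by gcongr)
      _ = η * ‖(x : E)‖ := by field_simp
  -- As `η < 1`, the lower estimate forces a trivial kernel; equality of dimensions then gives
  -- surjectivity.
  have hinj : Function.Injective T₀ := by
    rw [injective_iff_map_eq_zero]
    intro x hx
    have h1 := hest x
    rw [hx] at h1
    simp only [ZeroMemClass.coe_zero, norm_zero, zero_sub, abs_neg, abs_norm] at h1
    have h2 := norm_nonneg (x : E)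
    have h3 : ‖(x : E)‖ = 0 := by nlinarith
    exact Subtype.ext (norm_eq_zero.mp h3)
  have : FiniteDimensional ℝ (Submodule.span ℝ (Set.range w)) :=
    FiniteDimensional.span_of_finite ℝ (Set.finite_range w)
  -- The error at `vᵢ` is a relation of `v` evaluated on `w`: small by norm closeness, and zero if
  -- `w` satisfies the relations of `v`.
  have hdiff : ∀ (x : V₀) (i : ι), (x : E) = v i →
      (T₀ x : E) - w i = Fintype.linearCombination ℝ w (s (e i) - Pi.single i 1) := by
    intro x i hx
    obtain rfl : x = e i := Subtype.ext hx
    rw [hT₀, map_sub, Fintype.linearCombination_apply_single, one_smul]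
  refine ⟨LinearMap.linearEquivOfInjective T₀ hinj hfin, fun x => ?_, fun x i hx => ?_,
    fun hk x i hx => ?_⟩
  · rw [LinearMap.linearEquivOfInjective_apply]
    have h1 := abs_le.mp (hest x)
    have h2 : η * ‖(x : E)‖ ≤ ε * ‖(x : E)‖ := by gcongr
    constructor <;> linarith
  · rw [LinearMap.linearEquivOfInjective_apply, hdiff x i hx]
    have h1 := hvw (s (e i) - Pi.single i 1)
    rw [hker, norm_zero, sub_zero, abs_norm] at h1
    calc _ ≤ _ := h1
      _ ≤ η / K * K := by gcongr; exact hK2 i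
      _ = η := by field_simp
      _ < ε := hηε
  · rw [LinearMap.linearEquivOfInjective_apply, ← sub_eq_zero, hdiff x i hx]
    exact hk (hker i)

/-! ### Affine isomorphisms and vertices of polyhedra -/

section Affine

variable {E F : Type*} [NormedAddCommGroup E] [NormedSpace ℝ E]
  [NormedAddCommGroup F] [NormedSpace ℝ F]

/-- The affine isomorphism with a prescribed linear part and prescribed base points. -/
noncomputable def affineEquivOfBasePoints {P : AffineSubspace ℝ E} {Q : AffineSubspace ℝ F}
    [Nonempty P] [Nonempty Q] (T : P.direction ≃ₗ[ℝ] Q.direction) (p : P) (q : Q) : P ≃ᵃ[ℝ] Q :=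
  ((AffineEquiv.vaddConst ℝ p).symm.trans T.toAffineEquiv).trans (AffineEquiv.vaddConst ℝ q)

theorem coe_affineEquivOfBasePoints {P : AffineSubspace ℝ E} {Q : AffineSubspace ℝ F}
    [Nonempty P] [Nonempty Q] (T : P.direction ≃ₗ[ℝ] Q.direction) (p : P) (q : Q) (x : P) :
    (affineEquivOfBasePoints T p q x : F) = (T (x -ᵥ p) : F) + q := rfl

/-- The norms of combinations of differences from the initial point control affine isomorphisms
between the affine hulls of two finite families. -/
theorem exists_affineEquiv_of_normClose {k : ℕ} (y : Fin (k + 1) → E) {ε : ℝ} (hε : 0 < ε) :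
    ∃ δ > 0, ∀ (z : Fin (k + 1) → E) (H H' : Set E) [Nonempty H] [Nonempty H'],
      NormClose δ (fun i => y i - y 0) (fun i => z i - z 0) →
      affineSpan ℝ H = affineSpan ℝ (Set.range y) → affineSpan ℝ H' = affineSpan ℝ (Set.range z) →
      Module.finrank ℝ (affineSpan ℝ H).direction = Module.finrank ℝ (affineSpan ℝ H').direction →
      ∃ T : affineSpan ℝ H ≃ᵃ[ℝ] affineSpan ℝ H', IsAlmostIsometry ε T ∧
        (∀ (p : affineSpan ℝ H) (i : Fin (k + 1)), (p : E) = y i → ‖(T p : E) - z i‖ < ε) ∧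
        (AffineIndependent ℝ y →
          ∀ (p : affineSpan ℝ H) (i : Fin (k + 1)), (p : E) = y i → (T p : E) = z i) := by
  obtain ⟨δ, hδ, h⟩ := exists_linearEquiv_of_normClose (fun i => y i - y 0) hε
  refine ⟨δ, hδ, ?_⟩
  intro z H H' _ _ hyz hH hH' hfin
  have hdir : ∀ (K : Set E) (x : Fin (k + 1) → E), affineSpan ℝ K = affineSpan ℝ (Set.range x) →
      (affineSpan ℝ K).direction = Submodule.span ℝ (Set.range fun i => x i - x 0) := by
    intro K x hK
    rw [hK, direction_affineSpan, vectorSpan_range_eq_span_range_vsub_right ℝ x 0]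
    rfl
  obtain ⟨T, hT1, hT2, hT3⟩ := h _ _ _ hyz (hdir H y hH) (hdir H' z hH') hfin
  let p₀ : affineSpan ℝ H := ⟨y 0, hH ▸ subset_affineSpan ℝ _ ⟨0, rfl⟩⟩
  let q₀ : affineSpan ℝ H' := ⟨z 0, hH' ▸ subset_affineSpan ℝ _ ⟨0, rfl⟩⟩
  have hdist : ∀ (p : affineSpan ℝ H) i, (p : E) = y i →
      (affineEquivOfBasePoints T p₀ q₀ p : E) - z i = (T (p -ᵥ p₀) : E) - (z i - z 0) := by
    intro p i hp
    rw [coe_affineEquivOfBasePoints]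
    simp only [q₀]
    abel
  have hvsub : ∀ (p : affineSpan ℝ H) i, (p : E) = y i →
      ((p -ᵥ p₀ : (affineSpan ℝ H).direction) : E) = y i - y 0 := by
    intro p i hp
    rw [AffineSubspace.coe_vsub, hp]
    rfl
  refine ⟨affineEquivOfBasePoints T p₀ q₀, fun a b => ?_, fun p i hp => ?_, fun hy p i hp => ?_⟩
  · have h1 := hT1 (a -ᵥ b)
    rw [AffineSubspace.coe_vsub, vsub_eq_sub] at h1
    have h2 : (affineEquivOfBasePoints T p₀ q₀ a : E) - affineEquivOfBasePoints T p₀ q₀ b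
        = T (a -ᵥ b) := by
      rw [coe_affineEquivOfBasePoints, coe_affineEquivOfBasePoints, add_sub_add_right_eq_sub,
        ← Submodule.coe_sub, ← map_sub, vsub_sub_vsub_cancel_right]
    rw [h2]
    exact h1
  · rw [hdist p i hp]
    exact hT2 _ i (hvsub p i hp)
  · rw [← sub_eq_zero, hdist p i hp, sub_eq_zero]
    -- Under affine independence, a relation among the `yᵢ - y₀` can only involve index `0`, where
    -- the difference vanishes for `z` as well.
    refine hT3 (fun c hc => ?_) _ i (hvsub p i hp)
    rw [LinearMap.mem_ker, Fintype.linearCombination_apply,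
      Fintype.sum_eq_add_sum_subtype_ne _ (0 : Fin (k + 1)), sub_self, smul_zero, zero_add] at hc
    have hli := Fintype.linearIndependent_iff.mp
      ((affineIndependent_iff_linearIndependent_vsub ℝ y 0).mp hy) (fun i => c i) hc
    rw [LinearMap.mem_ker, Fintype.linearCombination_apply]
    refine Finset.sum_eq_zero fun j _ => ?_
    rcases eq_or_ne j 0 with rfl | hj
    · rw [sub_self, smul_zero]
    · rw [hli ⟨j, hj⟩, zero_smul]

theorem IsAlmostIsometry.trans {G : Type*} [NormedAddCommGroup G] [NormedSpace ℝ G]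
    {H : Set E} {H' : Set F} {H'' : Set G} [Nonempty H] [Nonempty H'] [Nonempty H'']
    {ε η : ℝ} {T : affineSpan ℝ H ≃ᵃ[ℝ] affineSpan ℝ H'} {S : affineSpan ℝ H' ≃ᵃ[ℝ] affineSpan ℝ H''}
    (hT : IsAlmostIsometry η T) (hS : IsAlmostIsometry η S) (hη : 0 < η) (hη1 : η ≤ 1)
    (hηε : 3 * η ≤ ε) : IsAlmostIsometry ε (T.trans S) := by
  intro x y
  obtain ⟨h1, h2⟩ := hT x y
  obtain ⟨h3, h4⟩ := hS (T x) (T y)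
  have h0 := norm_nonneg ((x : E) - y)
  simp only [AffineEquiv.trans_apply]
  have hsq : η * η ≤ η := by nlinarith
  constructor
  · calc (1 - ε) * ‖(x : E) - y‖ ≤ ((1 - η) * (1 - η)) * ‖(x : E) - y‖ := by
          gcongr; nlinarith
      _ = (1 - η) * ((1 - η) * ‖(x : E) - y‖) := by ring
      _ ≤ (1 - η) * ‖(T x : F) - T y‖ := by
          have : 0 ≤ 1 - η := by linarith
          gcongr
      _ ≤ _ := h3
  · calc _ ≤ _ := h4
      _ ≤ (1 + η) * ((1 + η) * ‖(x : E) - y‖) := by gcongr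
      _ = ((1 + η) * (1 + η)) * ‖(x : E) - y‖ := by ring
      _ ≤ (1 + ε) * ‖(x : E) - y‖ := by gcongr; nlinarith

/-- Affine isomorphisms carry vertices to vertices. -/
theorem vert_image_affineEquiv {H : Set E} {H' : Set F} [Nonempty H] [Nonempty H']
    (T : affineSpan ℝ H ≃ᵃ[ℝ] affineSpan ℝ H') :
    vert ((fun p : affineSpan ℝ H => (T p : F)) '' {p | (p : E) ∈ H}) =
      (fun p : affineSpan ℝ H => (T p : F)) '' {p | (p : E) ∈ vert H} := by
  have hinj : Function.Injective (fun p : affineSpan ℝ H => (T p : F)) :=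
    Subtype.val_injective.comp T.injective
  have hline : ∀ (a b : affineSpan ℝ H) (t : ℝ),
      (T (AffineMap.lineMap a b t) : F) = AffineMap.lineMap (T a : F) (T b : F) t := by
    intro a b t
    rw [T.apply_lineMap]
    exact (affineSpan ℝ H').subtype.apply_lineMap _ _ _
  have hline' : ∀ (a b : affineSpan ℝ H) (t : ℝ),
      ((AffineMap.lineMap a b t : affineSpan ℝ H) : E) = AffineMap.lineMap (a : E) (b : E) t :=
    fun a b t => (affineSpan ℝ H).subtype.apply_lineMap _ _ _
  have hseg : ∀ a b p : affineSpan ℝ H,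
      (T p : F) ∈ openSegment ℝ (T a : F) (T b : F) ↔ (p : E) ∈ openSegment ℝ (a : E) (b : E) := by
    intro a b p
    simp only [openSegment_eq_image_lineMap, Set.mem_image, ← hline, ← hline']
    simp only [Subtype.coe_injective.eq_iff, T.injective.eq_iff]
  ext q
  constructor
  · intro hq
    obtain ⟨⟨p, hp, rfl⟩, hq⟩ := mem_extremePoints.mp hq
    refine ⟨p, mem_extremePoints.mpr ⟨hp, fun a ha b hb hab => ?_⟩, rfl⟩
    have hmem : ∀ c ∈ H, c ∈ affineSpan ℝ H := fun c hc => subset_affineSpan ℝ _ hc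
    obtain ⟨h1, h2⟩ := hq _ ⟨⟨a, hmem a ha⟩, ha, rfl⟩ _ ⟨⟨b, hmem b hb⟩, hb, rfl⟩
      ((hseg _ _ _).mpr hab)
    exact ⟨congrArg Subtype.val (hinj h1), congrArg Subtype.val (hinj h2)⟩
  · rintro ⟨p, hp, rfl⟩
    obtain ⟨hp, hext⟩ := mem_extremePoints.mp hp
    refine mem_extremePoints.mpr ⟨⟨p, hp, rfl⟩, ?_⟩
    rintro _ ⟨a, ha, rfl⟩ _ ⟨b, hb, rfl⟩ hab
    obtain ⟨h1, h2⟩ := hext _ ha _ hb ((hseg _ _ _).mp hab)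
    rw [Subtype.ext h1, Subtype.ext h2]
    exact ⟨rfl, rfl⟩

theorem IsConvexPolyhedron.finite_vert {H : Set E} (h : IsConvexPolyhedron H) :
    (vert H).Finite := by
  obtain ⟨k, z, rfl⟩ := h
  exact (Set.finite_range z).subset extremePoints_convexHull_subset

/-- A convex polyhedron is the convex hull of its vertices. -/
theorem IsConvexPolyhedron.convexHull_vert {H : Set E} (h : IsConvexPolyhedron H) :
    convexHull ℝ (vert H) = H := by
  have hfin := h.finite_vert
  obtain ⟨k, z, rfl⟩ := h
  -- Krein–Milman; the closure is superfluous because the hull of finitely many vertices is closed.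
  have h1 := closure_convexHull_extremePoints ((Set.finite_range z).isCompact_convexHull ℝ)
    (convex_convexHull ℝ _)
  exact (hfin.isClosed_convexHull ℝ).closure_eq.symm.trans h1

theorem IsNMPolyhedron.vert_nonempty {n m : ℕ} {H : Set E} (h : IsNMPolyhedron n m H) :
    (vert H).Nonempty := by
  have := h.card_vert
  exact Set.nonempty_of_ncard_ne_zero (by lia)

/-- The vertices of an `(n, m)`-polyhedron can be listed by `Fin (n + m + 1)`. -/
theorem IsNMPolyhedron.exists_range_eq_vert {n m : ℕ} {H : Set E} (h : IsNMPolyhedron n m H) :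
    ∃ y : Fin (n + m + 1) → E, Set.range y = vert H := by
  have hfin := h.isConvexPolyhedron.finite_vert
  have := hfin.to_subtype
  let e : vert H ≃ Fin (n + m + 1) := Finite.equivFinOfCardEq h.card_vert
  exact ⟨fun i => (e.symm i : E), by
    rw [show (fun i => (e.symm i : E)) = Subtype.val ∘ e.symm from rfl, e.symm.surjective.range_comp,
      Subtype.range_val]⟩

theorem IsNMPolyhedron.affineSpan_eq {n m : ℕ} {H : Set E} (h : IsNMPolyhedron n m H) :
    affineSpan ℝ H = affineSpan ℝ (vert H) := by
  rw [← affineSpan_convexHull (vert H), h.isConvexPolyhedron.convexHull_vert]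

end Affine

/-! ### Transitivity of both notions -/

section Transitivity

variable {E F G : Type*} [NormedAddCommGroup E] [NormedSpace ℝ E]
  [NormedAddCommGroup F] [NormedSpace ℝ F] [NormedAddCommGroup G] [NormedSpace ℝ G]

theorem IsFinitelyRepresentable.trans {A : Set E} {B : Set F} {C : Set G}
    (hAB : IsFinitelyRepresentable A B) (hBC : IsFinitelyRepresentable B C) :
    IsFinitelyRepresentable A C := by
  intro ε hε n x hx hxA
  have hη : 0 < min ε 1 / 3 := by positivity
  have hη1 : min ε 1 / 3 ≤ 1 := by have := min_le_right ε 1; linarith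
  have hηε : 3 * (min ε 1 / 3) ≤ ε := by have := min_le_left ε 1; linarith
  obtain ⟨y, hy, hyB, T, hT, hTiso⟩ := hAB _ hη n x hx hxA
  obtain ⟨z, hz, hzC, S, hS, hSiso⟩ := hBC _ hη n y hy hyB
  exact ⟨z, hz, hzC, T.trans S, fun p j hp => hS _ j (hT p j hp),
    hTiso.trans hSiso hη hη1 hηε⟩

/-- `Metric.hausdorffDist` takes the value `0` when the extended distance is infinite, so finiteness
is needed before a small value yields nearby points. -/
theorem hausdorffEDist_vert_image_ne_top {n m : ℕ} {H : Set E} {H' : Set F} [Nonempty H]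
    [Nonempty H'] (T : affineSpan ℝ H ≃ᵃ[ℝ] affineSpan ℝ H') (hH : IsNMPolyhedron n m H)
    (hH' : IsNMPolyhedron n m H') :
    Metric.hausdorffEDist
      ((fun p : affineSpan ℝ H => (T p : F)) '' {p | (p : E) ∈ vert H}) (vert H') ≠ ⊤ := by
  refine Metric.hausdorffEDist_ne_top_of_nonempty_of_bounded ?_ hH'.vert_nonempty
    (((hH.isConvexPolyhedron.finite_vert.preimage Subtype.val_injective.injOn).image _).isBounded)
    hH'.isConvexPolyhedron.finite_vert.isBounded
  obtain ⟨x, hx⟩ := hH.vert_nonempty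
  exact ⟨_, ⟨x, subset_affineSpan ℝ _ (extremePoints_subset hx)⟩, hx, rfl⟩

theorem IsStronglyFinitelyRepresentable.trans {A : Set E} {B : Set F} {C : Set G}
    (hAB : IsStronglyFinitelyRepresentable A B) (hBC : IsStronglyFinitelyRepresentable B C) :
    IsStronglyFinitelyRepresentable A C := by
  intro ε hε n m H _ hH hHA
  set η := min ε 1 / 3 with hηdef
  have hη : 0 < η := by positivity
  have hη1 : η ≤ 1 := by have := min_le_right ε 1; linarith
  have hηε : 3 * η ≤ ε := by have := min_le_left ε 1; linarith
  obtain ⟨H', _, hH', hHB, T, hT, hTd⟩ := hAB η hη n m H hH hHA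
  obtain ⟨H'', _, hH'', hHC, S, hS, hSd⟩ := hBC η hη n m H' hH' hHB
  refine ⟨H'', inferInstance, hH'', hHC, T.trans S, hT.trans hS hη hη1 hηε, ?_⟩
  rw [vert_image_affineEquiv] at hTd hSd ⊢
  have hTtop := hausdorffEDist_vert_image_ne_top T hH hH'
  have hStop := hausdorffEDist_vert_image_ne_top S hH' hH''
  have hSlip : ∀ a b : affineSpan ℝ H', dist (a : F) b < η → dist (S a : G) (S b) ≤ 2 * η := by
    intro a b hab
    rw [dist_eq_norm] at hab ⊢
    refine (hS a b).2.trans ?_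
    have h0 := norm_nonneg ((a : F) - b)
    nlinarith
  -- The sup bound below is not strict; the slack `r < η` gives `2 * η + r < 3 * η ≤ ε`.
  obtain ⟨r, hrlt, hr⟩ : ∃ r < η, Metric.hausdorffDist
      ((fun p : affineSpan ℝ H' => (S p : G)) '' {p | (p : F) ∈ vert H'}) (vert H'') < r := by
    obtain ⟨r, h1, h2⟩ := exists_between hSd
    exact ⟨r, h2, h1⟩
  have hr0 : 0 ≤ r := Metric.hausdorffDist_nonneg.trans hr.le
  refine (Metric.hausdorffDist_le_of_mem_dist (r := 2 * η + r) (by positivity) ?_ ?_).trans_lt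
    (by linarith)
  · rintro _ ⟨p, hp, rfl⟩
    obtain ⟨b, hb, hpb⟩ := Metric.exists_dist_lt_of_hausdorffDist_lt
      (Set.mem_image_of_mem (fun p : affineSpan ℝ H => (T p : F)) hp) hTd hTtop
    let b' : affineSpan ℝ H' := ⟨b, subset_affineSpan ℝ _ (extremePoints_subset hb)⟩
    obtain ⟨c, hc, hbc⟩ := Metric.exists_dist_lt_of_hausdorffDist_lt
      (Set.mem_image_of_mem (fun p : affineSpan ℝ H' => (S p : G))
        (show b' ∈ {p : affineSpan ℝ H' | (p : F) ∈ vert H'} from hb)) hr hStop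
    exact ⟨c, hc, (dist_triangle _ _ _).trans (add_le_add (hSlip (T p) b' hpb) hbc.le)⟩
  · intro c hc
    obtain ⟨_, ⟨b, hb, rfl⟩, hbc⟩ := Metric.exists_dist_lt_of_hausdorffDist_lt' hc hr hStop
    obtain ⟨_, ⟨p, hp, rfl⟩, hpb⟩ := Metric.exists_dist_lt_of_hausdorffDist_lt'
      (show (b : F) ∈ vert H' from hb) hTd hTtop
    refine ⟨_, ⟨p, hp, rfl⟩, ?_⟩
    rw [dist_comm]
    exact (dist_triangle _ _ _).trans (add_le_add (hSlip (T p) b hpb) hbc.le)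

end Transitivity

/-! ### Representing a set in a countable subset -/

section CountableReduction

variable {E : Type*} [NormedAddCommGroup E] [NormedSpace ℝ E]

theorem exists_countable_isFinitelyRepresentable (B : Set E) :
    ∃ B₀ ⊆ B, B₀.Countable ∧ IsFinitelyRepresentable B B₀ := by
  -- Selecting only among affinely independent tuples makes the dimensions of the hulls agree.
  choose D hDS hDc hD using fun n : ℕ => exists_countable_normClose
    {y : Fin (n + 1) → E | AffineIndependent ℝ y ∧ ∀ j, y j ∈ B} (fun y i => y i - y 0)
  refine ⟨⋃ n, ⋃ y ∈ D n, Set.range y, ?_, ?_, ?_⟩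
  · simp only [Set.iUnion_subset_iff, Set.range_subset_iff]
    exact fun n y hy => (hDS n hy).2
  · exact Set.countable_iUnion fun n => (hDc n).biUnion fun y _ => Set.countable_range y
  · intro ε hε n x hx hxB
    obtain ⟨δ, hδ, h⟩ := exists_affineEquiv_of_normClose x hε
    obtain ⟨y, hyD, hxy⟩ := hD n x ⟨hx, hxB⟩ δ hδ
    have hy := (hDS n hyD).1
    obtain ⟨T, hT, -, hTx⟩ := h y (convexHull ℝ (Set.range x)) (convexHull ℝ (Set.range y)) hxy
      (affineSpan_convexHull _) (affineSpan_convexHull _) (by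
        rw [affineSpan_convexHull, affineSpan_convexHull, direction_affineSpan,
          direction_affineSpan, hx.finrank_vectorSpan (Fintype.card_fin _),
          hy.finrank_vectorSpan (Fintype.card_fin _)])
    refine ⟨y, hy, fun j => ?_, T, hTx hx, hT⟩
    simp only [Set.mem_iUnion]
    exact ⟨n, y, hyD, j, rfl⟩

theorem exists_countable_isStronglyFinitelyRepresentable (B : Set E) :
    ∃ B₀ ⊆ B, B₀.Countable ∧ IsStronglyFinitelyRepresentable B B₀ := by
  choose D hDS hDc hD using fun n m : ℕ => exists_countable_normClose
    {y : Fin (n + m + 1) → E | (∀ j, y j ∈ B) ∧ ∃ H, IsNMPolyhedron n m H ∧ Set.range y = vert H}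
    (fun y i => y i - y 0)
  refine ⟨⋃ n, ⋃ m, ⋃ y ∈ D n m, Set.range y, ?_, ?_, ?_⟩
  · simp only [Set.iUnion_subset_iff, Set.range_subset_iff]
    exact fun n m y hy => (hDS n m hy).1
  · exact Set.countable_iUnion fun n => Set.countable_iUnion fun m =>
      (hDc n m).biUnion fun y _ => Set.countable_range y
  · intro ε hε n m H _ hH hHB
    obtain ⟨y, hyH⟩ := hH.exists_range_eq_vert
    -- Halving `ε` leaves room for the strict Hausdorff bound. Vertices correspond by index, up to
    -- `ε / 2`.
    obtain ⟨δ, hδ, h⟩ := exists_affineEquiv_of_normClose y (half_pos hε)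
    obtain ⟨z, hzD, hyz⟩ := hD n m y ⟨fun j => hHB (hyH ▸ ⟨j, rfl⟩), H, hH, hyH⟩ δ hδ
    obtain ⟨-, H', hH', hzH'⟩ := hDS n m hzD
    have : Nonempty H' := (hH'.vert_nonempty.mono extremePoints_subset).to_subtype
    obtain ⟨T, hT, hTy, -⟩ := h z H H' hyz (hyH ▸ hH.affineSpan_eq) (hzH' ▸ hH'.affineSpan_eq)
      (hH.dim_eq.trans hH'.dim_eq.symm)
    refine ⟨H', this, hH', ?_, T, ?_, ?_⟩
    · rw [← hzH', Set.range_subset_iff]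
      intro j
      simp only [Set.mem_iUnion]
      exact ⟨n, m, z, hzD, j, rfl⟩
    · intro p q
      obtain ⟨h1, h2⟩ := hT p q
      have h0 := norm_nonneg ((p : E) - q)
      constructor <;> nlinarith
    · rw [vert_image_affineEquiv, ← hyH, ← hzH']
      refine (Metric.hausdorffDist_le_of_mem_dist (half_pos hε).le ?_ ?_).trans_lt (half_lt_self hε)
      · rintro _ ⟨p, ⟨i, hi⟩, rfl⟩
        exact ⟨z i, ⟨i, rfl⟩, (dist_eq_norm _ _).trans_le (hTy p i hi.symm).le⟩
      · rintro _ ⟨i, rfl⟩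
        have hi : y i ∈ affineSpan ℝ H :=
          subset_affineSpan ℝ _ (extremePoints_subset (hyH ▸ ⟨i, rfl⟩ : y i ∈ vert H))
        refine ⟨_, ⟨⟨y i, hi⟩, ⟨i, rfl⟩, rfl⟩, ?_⟩
        rw [dist_comm]
        exact (dist_eq_norm _ _).trans_le (hTy _ i rfl).le

end CountableReduction

theorem corollary4p10 {X Y : Type*}
    [NormedAddCommGroup X] [NormedSpace ℝ X] [CompleteSpace X]
    [NormedAddCommGroup Y] [NormedSpace ℝ Y] [CompleteSpace Y]
    (A : Set X) (B : Set Y) :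
    (IsFinitelyRepresentable A B →
      ∃ B₀ : Set Y, B₀ ⊆ B ∧ B₀.Countable ∧ IsFinitelyRepresentable A B₀) ∧
    (IsStronglyFinitelyRepresentable A B →
      ∃ B₀ : Set Y, B₀ ⊆ B ∧ B₀.Countable ∧ IsStronglyFinitelyRepresentable A B₀) := by
  constructor
  · intro h
    obtain ⟨B₀, hB₀, hc, hr⟩ := exists_countable_isFinitelyRepresentable B
    exact ⟨B₀, hB₀, hc, h.trans hr⟩
  · intro h
    obtain ⟨B₀, hB₀, hc, hr⟩ := exists_countable_isStronglyFinitelyRepresentable B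
    exact ⟨B₀, hB₀, hc, h.trans hr⟩
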